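/- **Corollary (Bound on the spectral gap).** Graphs are undirected; multiple edges and loops are allowed. A Jacobi matrix on a finite graph with positive edge weights $a_e$ and real potential $b_v$ is the symmetric matrix with $J_{vv}=b_v+2\sum_{e\text{ loop at }v}a_e$ and $J_{vw}=\sum_{e\text{ between }v\text{ and }w}a_e$ for $v\neq w$. Let $\mathcal G_0$ be a finite connected graph with $p$ vertices and first Betti number $\ell$, and let $J_0$ be a Jacobi matrix on $\mathcal G_0$. Choose $\ell$ edges $e_1,\dots,e_\ell$ of $\mathcal G_0$, each with a direction, whose removal turns $\mathcal G_0$ into a tree, and put $d=2\ell$. Let $A_i$ be the $p\times p$ matrix whose only nonzero entry is $a_{e_i}$, in the row of the initial vertex and the column of the terminal vertex of $e_i$, and let $A=\sum_{i=1}^{\ell}(A_i+A_i^*)$. Let $\mathcal G$ be a finite cover of $\mathcal G_0$ (not necessarily connected) and let $J$ be the lift of $J_0$ to $\mathcal G$, that is, the Jacobi matrix on $\mathcal G$ in which every edge and vertex carries the parameter of its image in $\mathcal G_0$. Let $G$ be the skeleton of $\mathcal G$: the $d$-regular multigraph whose vertices are the copies of the tree in $\mathcal G$ (the connected components of the part of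 $\mathcal G$ that lies over the tree) and whose edges are the edges of $\mathcal G$ that lie over one of the $e_i$. An edge of $G$ has weight $A_i$ or $A_i^*$, depending on its direction, if it lies over $e_i$. Let $r>0$ and $j\in\{1,\dots,\ell\}$, and suppose that $G$ has two edges, both with weight $A_j$ or $A_j^*$, such that every end of the first has distance greater than $2r+2$ in $G$ from every end of the second (the distance between different components of $G$ being infinite). Let $y$ be the normalized Perron–Frobenius eigenvector of $J_0$, that is, the unit vector with positive entries in the eigenspace of the largest eigenvalue of $J_0$. Let $\lambda_1(J)\ge\lambda_2(J)$ be the two largest eigenvalues of $J$, counted with multiplicity. Then $$\lambda_1(J)-\lambda_2(J)\;\le\;\bigl(d-2\sqrt{d-1}\bigr)\frac{\langle Ay,y\rangle}{d}+\frac{C_j}{r},$$ where $$C_j=\bigl(2\sqrt{d-1}-1\bigr)\frac{\langle Ay,y\rangle}{d}+\left|\frac{\langle Ay,y\rangle}{d}-\langle A_jy,y\rangle\right|.$$ -/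

import Mathlib

open scoped Matrix ENNReal

/-- An undirected graph with vertex set `V`, multiple edges and loops allowed. `D` is the set of
half-edges (edges with a direction): `src d` is the initial vertex of `d`, and `inv d` is the same
edge with the opposite direction. An undirected edge is a pair `{d, inv d}`; a loop at `v` is such
a pair with both half-edges at `v`. -/
structure MultiGraph (V D : Type*) where
  src : D → V
  inv : D → D
  inv_inv : ∀ d, inv (inv d) = d
  inv_ne : ∀ d, inv d ≠ d

namespace MultiGraph

variable {V D V₀ D₀ : Type*}

/-- The terminal vertex of a half-edge. -/
def tgt (G : MultiGraph V D) (d : D) : V := G.src (G.inv d)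

/-- The simple graph in which two distinct vertices are adjacent when some edge joins them.
It carries the connectivity and the path distance of the multigraph. -/
def adjGraph (G : MultiGraph V D) : SimpleGraph V :=
  SimpleGraph.fromRel fun v w => ∃ d, G.src d = v ∧ G.tgt d = w

/-- The subgraph with all the vertices and only the edges in `S`. -/
def keep (G : MultiGraph V D) (S : Set D) (hS : ∀ d ∈ S, G.inv d ∈ S) : MultiGraph V S where
  src d := G.src d
  inv d := ⟨G.inv d, hS d d.2⟩
  inv_inv d := Subtype.ext (G.inv_inv d)
  inv_ne d h := G.inv_ne d (congrArg Subtype.val h)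

/-- A tree: no loops, no multiple edges, connected and without cycles. -/
structure IsTree (G : MultiGraph V D) : Prop where
  no_loop : ∀ d, G.src d ≠ G.tgt d
  no_multi : ∀ d d', G.src d = G.src d' → G.tgt d = G.tgt d' → d = d'
  isTree : G.adjGraph.IsTree

/-- A covering map of graphs: a map of vertices and half-edges that respects initial vertices and
reversal and is a bijection from the half-edges at each vertex `v` to those at its image. -/
structure Covering (G : MultiGraph V D) (G₀ : MultiGraph V₀ D₀) where
  onV : V → V₀
  onD : D → D₀
  map_src : ∀ d, onV (G.src d) = G₀.src (onD d)
  map_inv : ∀ d, onD (G.inv d) = G₀.inv (onD d)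
  lift_unique : ∀ v d₀, G₀.src d₀ = onV v → ∃! d, G.src d = v ∧ onD d = d₀

/-- The half-edges of the edges `e 0, …, e (ℓ - 1)`. -/
def halfEdges (G : MultiGraph V D) {ℓ : ℕ} (e : Fin ℓ → D) : Set D :=
  {d | ∃ i, d = e i ∨ d = G.inv (e i)}

theorem inv_mem_halfEdges (G : MultiGraph V D) {ℓ : ℕ} (e : Fin ℓ → D) :
    ∀ d ∈ G.halfEdges e, G.inv d ∈ G.halfEdges e := by
  rintro d ⟨i, rfl | rfl⟩
  · exact ⟨i, Or.inr rfl⟩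
  · exact ⟨i, Or.inl (G.inv_inv _)⟩

theorem inv_mem_compl_halfEdges (G : MultiGraph V D) {ℓ : ℕ} (e : Fin ℓ → D) :
    ∀ d ∈ (G.halfEdges e)ᶜ, G.inv d ∈ (G.halfEdges e)ᶜ := by
  intro d hd h
  have := G.inv_mem_halfEdges e _ h
  rw [G.inv_inv] at this
  exact hd this

/-- A choice of `ℓ` distinct edges of `G`, each with a direction, whose removal turns `G` into a
tree. (Such a choice exists exactly when `G` is connected and `ℓ` is its first Betti number.) -/
structure TreeCut (G : MultiGraph V D) (ℓ : ℕ) where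
  e : Fin ℓ → D
  injective : Function.Injective e
  ne_inv : ∀ i k, e i ≠ G.inv (e k)
  isTree : (G.keep (G.halfEdges e)ᶜ (G.inv_mem_compl_halfEdges e)).IsTree

namespace Covering

variable {G : MultiGraph V D} {G₀ : MultiGraph V₀ D₀} {ℓ : ℕ}

/-- The part of the cover that lies over the tree. -/
def overTree (π : Covering G G₀) (T : TreeCut G₀ ℓ) :
    MultiGraph V (π.onD ⁻¹' (G₀.halfEdges T.e)ᶜ : Set D) :=
  G.keep _ fun d hd => by
    change π.onD (G.inv d) ∈ (G₀.halfEdges T.e)ᶜ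
    rw [π.map_inv]
    exact G₀.inv_mem_compl_halfEdges T.e _ hd

/-- The copies of the tree (of the building block) that make up the cover. -/
abbrev Block (π : Covering G G₀) (T : TreeCut G₀ ℓ) : Type _ :=
  (π.overTree T).adjGraph.ConnectedComponent

/-- The skeleton of the cover, a `2ℓ`-regular multigraph: its vertices are the copies of the tree,
its edges are the edges of the cover that lie over one of the chosen edges `e i`. -/
def skeleton (π : Covering G G₀) (T : TreeCut G₀ ℓ) :
    MultiGraph (π.Block T) (π.onD ⁻¹' G₀.halfEdges T.e : Set D) where
  src d := (π.overTree T).adjGraph.connectedComponentMk (G.src d)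
  inv d := ⟨G.inv d, by
    change π.onD (G.inv d) ∈ G₀.halfEdges T.e
    rw [π.map_inv]
    exact G₀.inv_mem_halfEdges T.e _ d.2⟩
  inv_inv d := Subtype.ext (G.inv_inv d)
  inv_ne d h := G.inv_ne d (congrArg Subtype.val h)

/-- A skeleton edge over `e j`, in one of its two directions; these are the edges with weight
`A j` or its transpose. -/
def IsOver (π : Covering G G₀) (T : TreeCut G₀ ℓ) (j : Fin ℓ)
    (d : (π.onD ⁻¹' G₀.halfEdges T.e : Set D)) : Prop :=
  π.onD d = T.e j ∨ π.onD d = G₀.inv (T.e j)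

end Covering

/-- The parameters of a Jacobi matrix on a graph: positive edge weights and a real potential. -/
structure Jacobi (G : MultiGraph V D) where
  a : D → ℝ
  b : V → ℝ
  a_pos : ∀ d, 0 < a d
  a_inv : ∀ d, a (G.inv d) = a d

namespace Jacobi

variable {G : MultiGraph V D} {G₀ : MultiGraph V₀ D₀}

/-- The Jacobi matrix. The sum is over half-edges from `v` to `w`, so an edge between distinct
vertices counts once and a loop counts twice. -/
def matrix [DecidableEq V] [Fintype D] (J : Jacobi G) : Matrix V V ℝ :=
  Matrix.of fun v w =>
    (if v = w then J.b v else 0) + ∑ d with G.src d = v ∧ G.tgt d = w, J.a d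

theorem isHermitian_matrix [DecidableEq V] [Fintype D] (J : Jacobi G) :
    J.matrix.IsHermitian := by
  ext v w
  simp only [matrix, Matrix.conjTranspose_apply, Matrix.of_apply, star_trivial]
  congr 1
  · by_cases h : v = w
    · simp [h]
    · simp [h, Ne.symm h]
  · refine Finset.sum_bij' (fun d _ => G.inv d) (fun d _ => G.inv d) ?_ ?_ ?_ ?_ ?_
    · intro d hd
      have h := (Finset.mem_filter.mp hd).2
      refine Finset.mem_filter.mpr ⟨Finset.mem_univ _, h.2, ?_⟩
      rw [tgt, G.inv_inv]
      exact h.1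
    · intro d hd
      have h := (Finset.mem_filter.mp hd).2
      refine Finset.mem_filter.mpr ⟨Finset.mem_univ _, h.2, ?_⟩
      rw [tgt, G.inv_inv]
      exact h.1
    · intro d _; exact G.inv_inv d
    · intro d _; exact G.inv_inv d
    · intro d _; exact (J.a_inv d).symm

/-- The eigenvalues in decreasing order, with multiplicity: `J.eig k` is `λ_{k+1}(J)`
(and `0` if there are at most `k` vertices). -/
noncomputable def eig [Fintype V] [DecidableEq V] [Fintype D] (J : Jacobi G) (k : ℕ) : ℝ :=
  if h : k < Fintype.card V then J.isHermitian_matrix.eigenvalues₀ ⟨k, h⟩ else 0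

/-- The lift to a cover: every edge and vertex carries the parameter of its image. -/
def lift (J₀ : Jacobi G₀) (π : Covering G G₀) : Jacobi G where
  a d := J₀.a (π.onD d)
  b v := J₀.b (π.onV v)
  a_pos d := J₀.a_pos _
  a_inv d := by rw [π.map_inv, J₀.a_inv]

/-- `A i`: its only nonzero entry is the weight of `e i`, in the row of the initial vertex and the
column of the terminal vertex of `e i`. -/
def cutMatrix [DecidableEq V] {ℓ : ℕ} (J : Jacobi G) (T : TreeCut G ℓ) (i : Fin ℓ) :
    Matrix V V ℝ :=
  Matrix.single (G.src (T.e i)) (G.tgt (T.e i)) (J.a (T.e i))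

/-- `A = ∑ i, (A i + (A i)ᵀ)`. -/
def totalCutMatrix [DecidableEq V] {ℓ : ℕ} (J : Jacobi G) (T : TreeCut G ℓ) : Matrix V V ℝ :=
  ∑ i, (J.cutMatrix T i + (J.cutMatrix T i)ᵀ)

/-- `y` is the normalized Perron–Frobenius eigenvector: a unit vector with positive entries in the
eigenspace of the largest eigenvalue. -/
structure IsPerronVector [Fintype V] [DecidableEq V] [Fintype D] (J : Jacobi G) (y : V → ℝ) :
    Prop where
  pos : ∀ v, 0 < y v
  unit : y ⬝ᵥ y = 1
  eigen : J.matrix *ᵥ y = J.eig 0 • y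

/-- The constant `C_j`, with `d = 2ℓ`. -/
noncomputable def errorConst [Fintype V] [DecidableEq V] {ℓ : ℕ} (J : Jacobi G) (T : TreeCut G ℓ)
    (y : V → ℝ) (j : Fin ℓ) : ℝ :=
  (2 * √(2 * (ℓ : ℝ) - 1) - 1) * (((J.totalCutMatrix T *ᵥ y) ⬝ᵥ y) / (2 * (ℓ : ℝ))) +
    |((J.totalCutMatrix T *ᵥ y) ⬝ᵥ y) / (2 * (ℓ : ℝ)) - (J.cutMatrix T j *ᵥ y) ⬝ᵥ y|

end Jacobi

end MultiGraph

/-!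
The proof is a weighted version of Nilli's argument for the Alon–Boppana bound.

Let `E` be the largest eigenvalue of `J₀` and `y` its positive eigenvector. The lift of `y` is a
positive eigenvector of the lift `J`, so the ground state representation
(`Jacobi.dotProduct_mulVec_mul`) gives, with `Y` the lift of `y`,
`⟨J (g Y), g Y⟩ = E ‖g Y‖² - ∑ a Y Y' (g - g')²`, the sum being over the edges. Hence `λ₁(J) ≤ E`.
If `g` is constant on the copies of the tree, only the cut edges contribute, and what remains is the
Dirichlet form of a function on the skeleton with weight `⟨A i y, y⟩` on the edges over `e i`; the
norm is preserved because each copy of the tree contains exactly one vertex over each vertex of the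
base (`Covering.existsUnique_block`).

It remains to find two functions on the skeleton, with disjoint supports that no edge joins, whose
Dirichlet forms are small; the max-min principle then bounds `λ₂(J)` from below. In the universal
cover of the skeleton, a regular tree of degree `q + 1 = 2ℓ`, take the function `q ^ (-k / 2)` at
distance `k ≤ n = ⌊r⌋` from a lift of the given edge, and push it forward by adding squares over the
fibres (`radial`). This preserves the norm, and by Cauchy–Schwarz it does not increase the
Dirichlet form (`le_radial_mul_radial`). The universal cover itself does not appear: it enters only
through the numbers of its half-edges at each level over a given half-edge (`nbCount`). The total
weight `W k` of the half-edges that lead to level `k` satisfies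
`W (k + 1) + W k = 2 (q + 1) m q ^ k` with `m` the average weight, so its deviation from `2 m q ^ k` only alternates in sign
(`sum_mul_nbCount`). This is the source of the term `|m - ⟨A j y, y⟩|`.
-/

/-! ### Walks without backtracking in a weighted regular multigraph -/

namespace MultiGraph

section NonBacktracking

variable {B H : Type*} [Fintype H] (G : MultiGraph B H)

theorem tgt_inv {V D : Type*} (G : MultiGraph V D) (d : D) : G.tgt (G.inv d) = G.src d := by
  rw [tgt, G.inv_inv]

/-- Reversal of half-edges, as a permutation. -/
def invEquiv {V D : Type*} (G : MultiGraph V D) : D ≃ D where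
  toFun := G.inv
  invFun := G.inv
  left_inv := G.inv_inv
  right_inv := G.inv_inv

theorem sum_inv {V D : Type*} [Fintype D] (G : MultiGraph V D) (f : D → ℝ) :
    ∑ d, f (G.inv d) = ∑ d, f d :=
  Equiv.sum_comp G.invEquiv f

theorem edist_src_tgt_le {V D : Type*} (G : MultiGraph V D) (h : D) :
    G.adjGraph.edist (G.src h) (G.tgt h) ≤ 1 := by
  rw [SimpleGraph.edist_le_one_iff_adj_or_eq]
  by_cases hne : G.src h = G.tgt h
  · exact Or.inr hne
  · exact Or.inl ((SimpleGraph.fromRel_adj _ _ _).2 ⟨hne, Or.inl ⟨h, rfl, rfl⟩⟩)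

open Classical in
/-- The number of walks without backtracking that start by traversing the edge of `e`, in either
direction, and whose last step, after `k` further steps, traverses the half-edge `h`. It counts the
half-edges over `h` in the universal cover that lead to level `k`, where the two ends of a fixed
lift of `e` form level `0`. -/
noncomputable def nbCount (e : H) : ℕ → H → ℝ
  | 0, h => if h = e ∨ h = G.inv e then 1 else 0
  | k + 1, h => ∑ h' with G.tgt h' = G.src h ∧ h' ≠ G.inv h, nbCount e k h'

open Classical in
/-- The number of vertices at level `k` of the universal cover that lie over `b`. -/
noncomputable def nbLevel (e : H) (k : ℕ) (b : B) : ℝ :=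
  ∑ h with G.tgt h = b, G.nbCount e k h

variable (e : H)

theorem nbCount_nonneg (k : ℕ) (h : H) : 0 ≤ G.nbCount e k h := by
  induction k generalizing h with
  | zero => rw [nbCount]; split_ifs <;> norm_num
  | succ k ih => rw [nbCount]; exact Finset.sum_nonneg fun h' _ => ih h'

theorem nbLevel_nonneg (k : ℕ) (b : B) : 0 ≤ G.nbLevel e k b :=
  Finset.sum_nonneg fun h _ => G.nbCount_nonneg e k h

theorem nbCount_zero_inv (h : H) : G.nbCount e 0 (G.inv h) = G.nbCount e 0 h := by
  classical
  have h1 : G.inv h = e ↔ h = G.inv e :=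
    ⟨fun h => by rw [← h, G.inv_inv], fun h => by rw [h, G.inv_inv]⟩
  have h2 : G.inv h = G.inv e ↔ h = e := G.invEquiv.injective.eq_iff
  rw [nbCount, nbCount]
  exact if_congr (by rw [h1, h2, or_comm]) rfl rfl

/-- A walk that arrives at the initial vertex of `h` either has just traversed `h` backwards or can
be continued along `h`. -/
theorem nbLevel_src (k : ℕ) (h : H) :
    G.nbLevel e k (G.src h) = G.nbCount e (k + 1) h + G.nbCount e k (G.inv h) := by
  classical
  rw [nbLevel, nbCount, ← Finset.sum_filter_add_sum_filter_not _ (fun h' => h' ≠ G.inv h),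
    Finset.filter_filter]
  congr 1
  rw [Finset.filter_filter, Finset.sum_eq_single_of_mem (G.inv h)]
  · simp [tgt_inv]
  · intro b hb hne
    exact absurd (Finset.mem_filter.mp hb).2.2 (not_not.2 hne)

theorem nbLevel_tgt (k : ℕ) (h : H) :
    G.nbLevel e k (G.tgt h) = G.nbCount e (k + 1) (G.inv h) + G.nbCount e k h := by
  have := G.nbLevel_src e k (G.inv h)
  rwa [G.inv_inv] at this

open Classical in
/-- A sum over half-edges, grouped by initial vertices. -/
theorem sum_src_mul [Fintype B] (f : B → ℝ) (c : H → ℝ) (C : ℝ)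
    (hC : ∀ b, ∑ h with G.src h = b, c h = C) : ∑ h, c h * f (G.src h) = C * ∑ b, f b := by
  rw [← Finset.sum_fiberwise_of_maps_to (t := Finset.univ) (g := G.src)
    (fun _ _ => Finset.mem_univ _), Finset.mul_sum]
  refine Finset.sum_congr rfl fun b _ => ?_
  rw [← hC b, Finset.sum_mul]
  refine Finset.sum_congr rfl fun h hh => ?_
  rw [(Finset.mem_filter.mp hh).2]

theorem sum_nbLevel [Fintype B] (k : ℕ) : ∑ b, G.nbLevel e k b = ∑ h, G.nbCount e k h := by
  classical
  exact Finset.sum_fiberwise_of_maps_to (t := Finset.univ) (g := G.tgt)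
    (fun _ _ => Finset.mem_univ _) _

open Classical in
/-- The recursion for weighted edge counts at consecutive levels. -/
theorem sum_mul_nbCount_succ [Fintype B] (c : H → ℝ) (hc : ∀ h, c (G.inv h) = c h) (C : ℝ)
    (hC : ∀ b, ∑ h with G.src h = b, c h = C) (k : ℕ) :
    ∑ h, c h * G.nbCount e (k + 1) h =
      C * ∑ h, G.nbCount e k h - ∑ h, c h * G.nbCount e k h := by
  rw [← sum_nbLevel, ← G.sum_src_mul _ c C hC,
    ← G.sum_inv (fun h => c h * G.nbCount e k h), ← Finset.sum_sub_distrib]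
  refine Finset.sum_congr rfl fun h _ => ?_
  rw [nbLevel_src, hc]
  ring

theorem sum_mul_nbCount_zero (c : H → ℝ) (hc : ∀ h, c (G.inv h) = c h) :
    ∑ h, c h * G.nbCount e 0 h = 2 * c e := by
  classical
  simp only [nbCount, mul_ite, mul_one, mul_zero]
  rw [← Finset.sum_filter]
  have : Finset.univ.filter (fun h => h = e ∨ h = G.inv e) = {e, G.inv e} := by
    ext h; simp
  rw [this, Finset.sum_pair (G.inv_ne e).symm, hc]
  ring

open Classical in
/-- In a `(q + 1)`-regular graph, the universal cover has `2 q ^ k` vertices at level `k`. -/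
theorem sum_nbCount [Fintype B] (q : ℝ) (hq : ∀ b, ∑ h with G.src h = b, (1 : ℝ) = q + 1) (k : ℕ) :
    ∑ h, G.nbCount e k h = 2 * q ^ k := by
  induction k with
  | zero => simpa using G.sum_mul_nbCount_zero e (fun _ => 1) (fun _ => rfl)
  | succ k ih =>
    have := G.sum_mul_nbCount_succ e (fun _ => 1) (fun _ => rfl) _ hq k
    simp only [one_mul] at this
    rw [this, ih]
    ring

open Classical in
/-- The total weight of the edges that lead to level `k`. The deviation from the average weight
only alternates in sign, because the last step of a walk excludes one direction for the next. -/
theorem sum_mul_nbCount [Fintype B] (q : ℝ) (hq : ∀ b, ∑ h with G.src h = b, (1 : ℝ) = q + 1)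
    (c : H → ℝ) (hc : ∀ h, c (G.inv h) = c h) (m : ℝ)
    (hC : ∀ b, ∑ h with G.src h = b, c h = (q + 1) * m) (k : ℕ) :
    ∑ h, c h * G.nbCount e k h = 2 * (q ^ k * m - (-1) ^ k * (m - c e)) := by
  induction k with
  | zero => rw [G.sum_mul_nbCount_zero e c hc]; ring
  | succ k ih =>
    rw [G.sum_mul_nbCount_succ e c hc _ hC, ih, G.sum_nbCount e q hq]
    ring

theorem exists_edist_le_of_nbCount_ne_zero (k : ℕ) (h : H) (hk : G.nbCount e k h ≠ 0) :
    ∃ s ∈ ({G.src e, G.tgt e} : Set B), G.adjGraph.edist s (G.tgt h) ≤ k := by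
  classical
  induction k generalizing h with
  | zero =>
    rw [nbCount] at hk
    have : h = e ∨ h = G.inv e := by by_contra hn; exact hk (if_neg hn)
    rcases this with rfl | rfl
    · exact ⟨G.tgt h, by simp, by simp⟩
    · exact ⟨G.src e, by simp, by simp [tgt_inv]⟩
  | succ k ih =>
    rw [nbCount] at hk
    obtain ⟨h', hh', hne⟩ := Finset.exists_ne_zero_of_sum_ne_zero hk
    obtain ⟨s, hs, hle⟩ := ih h' hne
    rw [(Finset.mem_filter.mp hh').2.1] at hle
    refine ⟨s, hs, (SimpleGraph.edist_triangle (v := G.src h)).trans ?_⟩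
    push_cast
    exact add_le_add hle (G.edist_src_tgt_le h)

/-- The push-forward to the graph of the radial function `q ^ (-k / 2)` at the levels
`k = 0, …, n` of the universal cover: the square root of the sum of its squares over the fibre. -/
noncomputable def radial (q : ℝ) (n : ℕ) (b : B) : ℝ :=
  √(∑ k ∈ Finset.range (n + 1), (q ^ k)⁻¹ * G.nbLevel e k b)

theorem exists_edist_le_of_radial_ne_zero (q : ℝ) (n : ℕ) (b : B) (hb : G.radial e q n b ≠ 0) :
    ∃ s ∈ ({G.src e, G.tgt e} : Set B), G.adjGraph.edist s b ≤ n := by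
  classical
  have h0 : ∑ k ∈ Finset.range (n + 1), (q ^ k)⁻¹ * G.nbLevel e k b ≠ 0 := by
    intro h; exact hb (by rw [radial, h, Real.sqrt_zero])
  obtain ⟨k, hk, hne⟩ := Finset.exists_ne_zero_of_sum_ne_zero h0
  obtain ⟨h, hh, hne'⟩ := Finset.exists_ne_zero_of_sum_ne_zero (right_ne_zero_of_mul hne)
  obtain ⟨s, hs, hle⟩ := G.exists_edist_le_of_nbCount_ne_zero e k h hne'
  rw [(Finset.mem_filter.mp hh).2] at hle
  refine ⟨s, hs, hle.trans ?_⟩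
  have := Finset.mem_range.mp hk
  exact_mod_cast Nat.lt_succ_iff.mp this

theorem radial_sq {q : ℝ} (hq : 0 < q) (n : ℕ) (b : B) :
    G.radial e q n b ^ 2 = ∑ k ∈ Finset.range (n + 1), (q ^ k)⁻¹ * G.nbLevel e k b :=
  Real.sq_sqrt (Finset.sum_nonneg fun k _ => mul_nonneg (by positivity) (G.nbLevel_nonneg e k b))

open Classical in
theorem sum_radial_sq [Fintype B] {q : ℝ} (hq0 : 0 < q)
    (hq : ∀ b, ∑ h with G.src h = b, (1 : ℝ) = q + 1) (n : ℕ) : ∑ b, G.radial e q n b ^ 2 = 2 * (n + 1) := by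
  simp only [G.radial_sq e hq0]
  rw [Finset.sum_comm]
  have : ∀ k ∈ Finset.range (n + 1), ∑ b, (q ^ k)⁻¹ * G.nbLevel e k b = 2 := by
    intro k _
    rw [← Finset.mul_sum, sum_nbLevel, G.sum_nbCount e q hq]
    field_simp
  rw [Finset.sum_congr rfl this]
  simp
  ring

/-- The Cauchy–Schwarz step: a lower bound for the product of the values at the ends of an edge by
the sum of such products over the lifts of the edge. -/
theorem le_sqrt_mul_sqrt {r s t p : ℝ} (hr : 0 ≤ r) (hs : 0 ≤ s) (ht : 0 ≤ t)
    {x y : ℝ} (hx : r + s + p ^ 2 * t ≤ x) (hy : r + p ^ 2 * s + t ≤ y) :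
    r + p * (s + t) ≤ √x * √y := by
  have h1 : 0 ≤ r + s + p ^ 2 * t := by positivity
  have h2 : 0 ≤ r + p ^ 2 * s + t := by positivity
  rw [← Real.sqrt_mul (h1.trans hx)]
  apply Real.le_sqrt_of_sq_le
  refine le_trans ?_ (mul_le_mul hx hy h2 (h1.trans hx))
  have h3 : 0 ≤ r * (s + t) * (1 - p) ^ 2 + s * t * (1 - p ^ 2) ^ 2 := by positivity
  linarith [h3]

/-- The product of the push-forwards at the ends of `h` is at least the sum, over the lifts of `h`
in the levels `0, …, n` of the universal cover, of the products of the radial values. Here `p` stands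
for `q ^ (-1 / 2)`. -/
theorem le_radial_mul_radial {p q : ℝ} (hpq : p ^ 2 * q = 1) (n : ℕ) (h : H) :
    G.nbCount e 0 h + p * (∑ k ∈ Finset.range n, (q ^ k)⁻¹ * G.nbCount e (k + 1) h +
        ∑ k ∈ Finset.range n, (q ^ k)⁻¹ * G.nbCount e (k + 1) (G.inv h)) ≤
      G.radial e q n (G.src h) * G.radial e q n (G.tgt h) := by
  have hq : 0 < q := by
    by_contra hn
    nlinarith [sq_nonneg p]
  have hp2 : p ^ 2 = q⁻¹ := eq_inv_of_mul_eq_one_left hpq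
  have key : ∀ g : H, G.nbCount e 0 g + p ^ 2 * ∑ k ∈ Finset.range n, (q ^ k)⁻¹ *
        G.nbCount e (k + 1) g =
      ∑ k ∈ Finset.range (n + 1), (q ^ k)⁻¹ * G.nbCount e k g := by
    intro g
    rw [Finset.sum_range_succ', Finset.mul_sum, hp2]
    simp only [pow_succ, mul_inv]
    rw [add_comm]
    congr 1
    · exact Finset.sum_congr rfl fun k _ => by ring
    · simp
  have up : ∀ g : H, ∑ k ∈ Finset.range n, (q ^ k)⁻¹ * G.nbCount e (k + 1) g ≤
      ∑ k ∈ Finset.range (n + 1), (q ^ k)⁻¹ * G.nbCount e (k + 1) g := fun g =>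
    Finset.sum_le_sum_of_subset_of_nonneg (Finset.range_subset_range.2 n.le_succ) fun k _ _ =>
      mul_nonneg (by positivity) (G.nbCount_nonneg e _ g)
  have nn : ∀ g : H, 0 ≤ ∑ k ∈ Finset.range n, (q ^ k)⁻¹ * G.nbCount e (k + 1) g := fun g =>
    Finset.sum_nonneg fun k _ => mul_nonneg (by positivity) (G.nbCount_nonneg e _ g)
  -- `r` collects the lifts of `e`, `s` and `t` those that lead away from and back to level `0`.
  refine le_sqrt_mul_sqrt (G.nbCount_nonneg e 0 h) (nn h) (nn _) ?_ ?_
  · simp only [nbLevel_src, mul_add, Finset.sum_add_distrib]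
    rw [← key (G.inv h), nbCount_zero_inv]
    linarith [up h]
  · simp only [nbLevel_tgt, mul_add, Finset.sum_add_distrib]
    rw [← key h]
    linarith [up (G.inv h)]

/-- The total error from the difference between `c e` and the average weight does not grow with the
number of levels. -/
theorem abs_one_sub_geom_le {p : ℝ} (hp : 0 ≤ p) (hp1 : p ≤ 1) (n : ℕ) :
    |1 - 2 * p * ∑ k ∈ Finset.range n, (-p ^ 2) ^ k| ≤ 1 := by
  have hS : 0 ≤ ∑ k ∈ Finset.range n, (-p ^ 2) ^ k ∧
      ∑ k ∈ Finset.range n, (-p ^ 2) ^ k ≤ 1 := by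
    induction n with
    | zero => simp
    | succ n ih =>
      have hs : ∑ k ∈ Finset.range (n + 1), (-p ^ 2) ^ k =
          1 - p * p * ∑ k ∈ Finset.range n, (-p ^ 2) ^ k := by
        rw [Finset.sum_range_succ', Finset.mul_sum, pow_zero, sub_eq_neg_add,
          ← Finset.sum_neg_distrib]
        congr 1
        exact Finset.sum_congr rfl fun k _ => by ring
      rw [hs]
      have hp2 : p * p ≤ 1 := mul_le_one₀ hp1 hp hp1
      have h1 := mul_le_one₀ hp2 ih.1 ih.2
      have h2 := mul_nonneg (mul_nonneg hp hp) ih.1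
      constructor <;> linarith
  rw [abs_le]
  constructor <;> nlinarith [hS.1, hS.2, mul_le_mul hp1 hS.2 hS.1 zero_le_one,
    mul_nonneg hp hS.1]

open Classical in
/-- The Dirichlet form of the radial test function in a `(q + 1)`-regular graph with edge weights
whose sum at each vertex is `(q + 1) * m`. Here `p` stands for `q ^ (-1 / 2)`, and the squared
norm of the test function is `2 * (n + 1)`. -/
theorem dirichlet_radial_le [Fintype B] {p q : ℝ} (hp : 0 < p) (hp1 : p ≤ 1) (hpq : p ^ 2 * q = 1)
    (hq : ∀ b, ∑ h with G.src h = b, (1 : ℝ) = q + 1)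
    (c : H → ℝ) (hc : ∀ h, c (G.inv h) = c h) (hc0 : ∀ h, 0 ≤ c h) (m : ℝ)
    (hC : ∀ b, ∑ h with G.src h = b, c h = (q + 1) * m) (n : ℕ) :
    (∑ h, c h * (G.radial e q n (G.src h) - G.radial e q n (G.tgt h)) ^ 2) / 2 ≤
      2 * (n + 1) * (q + 1 - 2 * (p * q)) * m + 2 * ((2 * (p * q) - 1) * m + |m - c e|) := by
  have hq0 : 0 < q := by
    by_contra hn
    nlinarith [sq_nonneg p]
  set F := G.radial e q n
  -- Half the Dirichlet form is the norm with vertex weights minus the sum of the edge products.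
  have hexp : (∑ h, c h * (F (G.src h) - F (G.tgt h)) ^ 2) / 2 =
      ∑ h, c h * F (G.src h) ^ 2 - ∑ h, c h * (F (G.src h) * F (G.tgt h)) := by
    have h1 : ∑ h, c h * F (G.tgt h) ^ 2 = ∑ h, c h * F (G.src h) ^ 2 := by
      rw [← G.sum_inv]
      exact Finset.sum_congr rfl fun h _ => by rw [hc, tgt_inv]
    have h2 : ∑ h, c h * (F (G.src h) - F (G.tgt h)) ^ 2 =
        ∑ h, c h * F (G.src h) ^ 2 + ∑ h, c h * F (G.tgt h) ^ 2 -
          2 * ∑ h, c h * (F (G.src h) * F (G.tgt h)) := by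
      rw [Finset.mul_sum, ← Finset.sum_add_distrib, ← Finset.sum_sub_distrib]
      exact Finset.sum_congr rfl fun h _ => by ring
    rw [h2, h1]
    ring
  have hnorm : ∑ h, c h * F (G.src h) ^ 2 = (q + 1) * m * (2 * (n + 1)) := by
    rw [G.sum_src_mul (fun b => F b ^ 2) c _ hC, G.sum_radial_sq e hq0 hq]
  have hW : ∑ k ∈ Finset.range n, (q ^ k)⁻¹ * ∑ h, c h * G.nbCount e (k + 1) h =
      2 * (n * (q * m) + (∑ k ∈ Finset.range n, (-p ^ 2) ^ k) * (m - c e)) := by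
    have : ∀ k ∈ Finset.range n, (q ^ k)⁻¹ * ∑ h, c h * G.nbCount e (k + 1) h =
        2 * (q * m) + 2 * ((-p ^ 2) ^ k * (m - c e)) := by
      intro k _
      have hpk : (q ^ k)⁻¹ = (p ^ 2) ^ k := by
        rw [eq_inv_of_mul_eq_one_left hpq, inv_pow]
      have hk : (p ^ 2) ^ k * q ^ k = 1 := by rw [← mul_pow, hpq, one_pow]
      rw [G.sum_mul_nbCount e q hq c hc m hC, hpk, neg_pow (p ^ 2)]
      linear_combination 2 * q * m * hk
    rw [Finset.sum_congr rfl this, Finset.sum_add_distrib, Finset.sum_const, Finset.card_range,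
      nsmul_eq_mul, ← Finset.mul_sum, ← Finset.sum_mul]
    ring
  have hW' : ∑ h, c h * (G.nbCount e 0 h + p * (∑ k ∈ Finset.range n, (q ^ k)⁻¹ *
          G.nbCount e (k + 1) h +
        ∑ k ∈ Finset.range n, (q ^ k)⁻¹ * G.nbCount e (k + 1) (G.inv h))) =
      2 * c e + 2 * p * ∑ k ∈ Finset.range n, (q ^ k)⁻¹ * ∑ h, c h * G.nbCount e (k + 1) h := by
    have h1 : ∑ h, c h * ∑ k ∈ Finset.range n, (q ^ k)⁻¹ * G.nbCount e (k + 1) h =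
        ∑ k ∈ Finset.range n, (q ^ k)⁻¹ * ∑ h, c h * G.nbCount e (k + 1) h := by
      simp only [Finset.mul_sum]
      rw [Finset.sum_comm]
      exact Finset.sum_congr rfl fun k _ => Finset.sum_congr rfl fun h _ => by ring
    have h2 : ∑ h, c h * ∑ k ∈ Finset.range n, (q ^ k)⁻¹ * G.nbCount e (k + 1) (G.inv h) =
        ∑ h, c h * ∑ k ∈ Finset.range n, (q ^ k)⁻¹ * G.nbCount e (k + 1) h := by
      rw [← G.sum_inv]
      exact Finset.sum_congr rfl fun h _ => by rw [hc, G.inv_inv]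
    rw [← G.sum_mul_nbCount_zero e c hc, ← h1, two_mul p, add_mul]
    nth_rewrite 2 [← h2]
    simp only [mul_add, Finset.sum_add_distrib, Finset.mul_sum]
    congr 1
    congr 1 <;> exact Finset.sum_congr rfl fun h _ => Finset.sum_congr rfl fun k _ => by ring
  have hprod : 2 * c e + 2 * p * (2 * (n * (q * m) +
      (∑ k ∈ Finset.range n, (-p ^ 2) ^ k) * (m - c e))) ≤
        ∑ h, c h * (F (G.src h) * F (G.tgt h)) := by
    rw [← hW, ← hW']
    exact Finset.sum_le_sum fun h _ =>
      mul_le_mul_of_nonneg_left (G.le_radial_mul_radial e hpq n h) (hc0 h)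
  have hε : (m - c e) * (1 - 2 * p * ∑ k ∈ Finset.range n, (-p ^ 2) ^ k) ≤ |m - c e| := by
    refine (le_abs_self _).trans ?_
    rw [abs_mul]
    exact mul_le_of_le_one_right (abs_nonneg _) (abs_one_sub_geom_le hp.le hp1 n)
  rw [hexp, hnorm]
  linarith [hprod, hε]

/-- Test functions around edges that are far apart have supports that are disjoint and not joined
by an edge. -/
theorem radial_separated {e₁ e₂ : H} {r : ℝ} (hr : 0 ≤ r)
    (hfar : ∀ s ∈ ({G.src e₁, G.tgt e₁} : Set B), ∀ t ∈ ({G.src e₂, G.tgt e₂} : Set B),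
      ENNReal.ofReal (2 * r + 2) < (G.adjGraph.edist s t : ℝ≥0∞))
    (q : ℝ) (b b' : B) (hbb : G.adjGraph.edist b b' ≤ 1) :
    G.radial e₁ q ⌊r⌋₊ b = 0 ∨ G.radial e₂ q ⌊r⌋₊ b' = 0 := by
  by_contra! hne
  obtain ⟨s, hs, hsb⟩ := G.exists_edist_le_of_radial_ne_zero e₁ q _ b hne.1
  obtain ⟨t, ht, htb⟩ := G.exists_edist_le_of_radial_ne_zero e₂ q _ b' hne.2
  have hst : G.adjGraph.edist s t ≤ ((2 * ⌊r⌋₊ + 1 : ℕ) : ℕ∞) := by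
    calc G.adjGraph.edist s t ≤ G.adjGraph.edist s b + G.adjGraph.edist b t :=
          SimpleGraph.edist_triangle
      _ ≤ G.adjGraph.edist s b + (G.adjGraph.edist b b' + G.adjGraph.edist b' t) := by
          gcongr; exact SimpleGraph.edist_triangle
      _ ≤ ⌊r⌋₊ + (1 + ⌊r⌋₊) := by
          rw [SimpleGraph.edist_comm (u := b') (v := t)]
          gcongr
      _ = ((2 * ⌊r⌋₊ + 1 : ℕ) : ℕ∞) := by push_cast; ring
  have h1 := (hfar s hs t ht).trans_le (ENat.toENNReal_le.2 hst)
  rw [ENat.toENNReal_coe, ← ENNReal.ofReal_natCast, ENNReal.ofReal_lt_ofReal_iff_of_nonneg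
    (by positivity)] at h1
  have h2 : (⌊r⌋₊ : ℝ) ≤ r := Nat.floor_le hr
  push_cast at h1
  linarith

theorem sum_sq_of_separated {B H : Type*} (G : MultiGraph B H) [Fintype B] {f g : B → ℝ}
    (hsep : ∀ b b', G.adjGraph.edist b b' ≤ 1 → f b = 0 ∨ g b' = 0) (x z : ℝ) :
    ∑ b, (x • f + z • g) b ^ 2 = x ^ 2 * ∑ b, f b ^ 2 + z ^ 2 * ∑ b, g b ^ 2 := by
  rw [Finset.mul_sum, Finset.mul_sum, ← Finset.sum_add_distrib]
  refine Finset.sum_congr rfl fun b _ => ?_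
  have h0 : f b * g b = 0 := mul_eq_zero.2 (hsep b b (by simp))
  simp only [Pi.add_apply, Pi.smul_apply, smul_eq_mul]
  linear_combination 2 * x * z * h0

theorem dirichlet_of_separated {f g : B → ℝ}
    (hsep : ∀ b b', G.adjGraph.edist b b' ≤ 1 → f b = 0 ∨ g b' = 0) (c : H → ℝ) (x z : ℝ) :
    ∑ h, c h * ((x • f + z • g) (G.src h) - (x • f + z • g) (G.tgt h)) ^ 2 =
      x ^ 2 * ∑ h, c h * (f (G.src h) - f (G.tgt h)) ^ 2 +
        z ^ 2 * ∑ h, c h * (g (G.src h) - g (G.tgt h)) ^ 2 := by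
  rw [Finset.mul_sum, Finset.mul_sum, ← Finset.sum_add_distrib]
  refine Finset.sum_congr rfl fun h _ => ?_
  have hle := G.edist_src_tgt_le h
  have h11 := mul_eq_zero.2 (hsep (G.src h) (G.src h) (by simp))
  have h12 := mul_eq_zero.2 (hsep (G.src h) (G.tgt h) hle)
  have h21 := mul_eq_zero.2 (hsep (G.tgt h) (G.src h) (by rwa [SimpleGraph.edist_comm]))
  have h22 := mul_eq_zero.2 (hsep (G.tgt h) (G.tgt h) (by simp))
  simp only [Pi.add_apply, Pi.smul_apply, smul_eq_mul]
  linear_combination 2 * x * z * c h * (h11 - h12 - h21 + h22)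

end NonBacktracking

end MultiGraph

/-! ### Coverings of trees and the blocks of a cover -/

namespace MultiGraph

variable {V D V₀ D₀ : Type*} {G : MultiGraph V D} {G₀ : MultiGraph V₀ D₀}

theorem adjGraph_adj_iff (G : MultiGraph V D) {v w : V} :
    G.adjGraph.Adj v w ↔ v ≠ w ∧ ∃ d, G.src d = v ∧ G.tgt d = w := by
  rw [adjGraph, SimpleGraph.fromRel_adj]
  refine and_congr_right fun _ => ⟨?_, Or.inl⟩
  rintro (h | ⟨d, h1, h2⟩)
  · exact h
  · exact ⟨G.inv d, h2, by rw [tgt_inv, h1]⟩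

theorem reachable_src_tgt (G : MultiGraph V D) (d : D) :
    G.adjGraph.Reachable (G.src d) (G.tgt d) := by
  by_cases h : G.src d = G.tgt d
  · rw [h]
  · exact (G.adjGraph_adj_iff.2 ⟨h, d, rfl, rfl⟩).reachable

namespace Covering

theorem map_tgt (π : Covering G G₀) (d : D) : π.onV (G.tgt d) = G₀.tgt (π.onD d) := by
  rw [tgt, π.map_src, π.map_inv, tgt]

/-- A covering of a tree maps neighbours to neighbours, as a tree has no loops. -/
def treeHom (π : Covering G G₀) (h : G₀.IsTree) : G.adjGraph →g G₀.adjGraph where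
  toFun := π.onV
  map_rel' := by
    intro v w hvw
    obtain ⟨-, d, rfl, rfl⟩ := G.adjGraph_adj_iff.1 hvw
    refine G₀.adjGraph_adj_iff.2 ⟨?_, π.onD d, (π.map_src d).symm, (π.map_tgt d).symm⟩
    rw [π.map_src, π.map_tgt]
    exact h.no_loop _

/-- A covering of a tree is injective on the neighbours of a vertex. -/
theorem eq_of_adj_of_adj (π : Covering G G₀) (h : G₀.IsTree) {u v w : V}
    (hv : G.adjGraph.Adj u v) (hw : G.adjGraph.Adj u w) (hvw : π.onV v = π.onV w) : v = w := by
  obtain ⟨-, d, hd, rfl⟩ := G.adjGraph_adj_iff.1 hv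
  obtain ⟨-, d', hd', rfl⟩ := G.adjGraph_adj_iff.1 hw
  have hD : π.onD d = π.onD d' := by
    apply h.no_multi
    · rw [← π.map_src, ← π.map_src, hd, hd']
    · rw [← π.map_tgt, ← π.map_tgt, hvw]
  have := (π.lift_unique u (π.onD d') (by rw [← π.map_src, hd'])).unique ⟨hd, hD⟩ ⟨hd', rfl⟩
  rw [this]

/-- A covering of a tree maps paths to walks without backtracking. -/
theorem isChain_edges_map (π : Covering G G₀) (h : G₀.IsTree) {v w : V} (p : G.adjGraph.Walk v w)
    (hp : p.IsPath) : List.IsChain (· ≠ ·) (p.map (π.treeHom h)).edges := by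
  induction p with
  | nil => simp
  | @cons u v w huv q ih =>
    have hq := (SimpleGraph.Walk.cons_isPath_iff _ _).1 hp
    cases q with
    | nil => simp
    | @cons _ x _ hvx q' =>
      have ih' := ih hq.1
      simp only [SimpleGraph.Walk.map_cons, SimpleGraph.Walk.edges_cons] at ih' ⊢
      rw [List.isChain_cons_cons]
      refine ⟨fun heq => ?_, ih'⟩
      have hux : π.onV u = π.onV x := by
        rcases Sym2.eq_iff.1 heq with ⟨-, h2⟩ | ⟨h1, -⟩
        · exact absurd h2 ((π.treeHom h).map_adj hvx).ne
        · exact h1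
      have := π.eq_of_adj_of_adj h huv.symm hvx hux
      apply hq.2
      rw [this]
      simp

/-- Trees are simply connected: every component of a cover of a tree contains exactly one vertex
over each vertex of the tree. -/
theorem existsUnique_of_isTree (π : Covering G G₀) (h : G₀.IsTree)
    (B : G.adjGraph.ConnectedComponent) (v₀ : V₀) :
    ∃! v, G.adjGraph.connectedComponentMk v = B ∧ π.onV v = v₀ := by
  classical
  apply existsUnique_of_exists_of_unique
  · induction B using SimpleGraph.ConnectedComponent.ind with | _ u =>
    obtain ⟨p⟩ := h.isTree.connected.preconnected (π.onV u) v₀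
    have key : ∀ (a b : V₀) (_ : G₀.adjGraph.Walk a b) (u : V), π.onV u = a →
        ∃ v, G.adjGraph.Reachable u v ∧ π.onV v = b := by
      intro a b p
      induction p with
      | nil => exact fun u hu => ⟨u, .rfl, hu⟩
      | cons hab q ih =>
        intro u hu
        obtain ⟨-, d₀, hs, ht⟩ := G₀.adjGraph_adj_iff.1 hab
        obtain ⟨d, ⟨hd, hd₀⟩, -⟩ := π.lift_unique u d₀ (by rw [hs, hu])
        obtain ⟨v, hv, hvb⟩ := ih (G.tgt d) (by rw [π.map_tgt, hd₀, ht])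
        refine ⟨v, SimpleGraph.Reachable.trans ?_ hv, hvb⟩
        rw [← hd]
        exact G.reachable_src_tgt d
    obtain ⟨v, hv, hv₀⟩ := key _ _ p u rfl
    exact ⟨v, SimpleGraph.ConnectedComponent.eq.2 hv.symm, hv₀⟩
  · rintro v w ⟨hv, hv₀⟩ ⟨hw, hw₀⟩
    obtain ⟨p⟩ := SimpleGraph.ConnectedComponent.exact (hv.trans hw.symm)
    have hpath := (h.isTree.isAcyclic.isPath_iff_isChain _).2
      (π.isChain_edges_map h p.toPath.1 p.toPath.2)
    have hlen : ∀ (a b : V₀) (q : G₀.adjGraph.Walk a b), q.IsPath → a = b → q.length = 0 := by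
      rintro a b q hq rfl
      exact SimpleGraph.Walk.length_eq_zero_iff.2 (SimpleGraph.Walk.isPath_iff_nil.1 hq)
    have := hlen _ _ _ hpath (hv₀.trans hw₀.symm)
    rw [SimpleGraph.Walk.length_map] at this
    exact SimpleGraph.Walk.eq_of_length_eq_zero this

/-- The part of the cover over the tree is a covering of the tree. -/
def treeCovering {ℓ : ℕ} (π : Covering G G₀) (T : TreeCut G₀ ℓ) :
    Covering (π.overTree T)
      (G₀.keep (G₀.halfEdges T.e)ᶜ (G₀.inv_mem_compl_halfEdges T.e)) where
  onV := π.onV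
  onD d := ⟨π.onD d, d.2⟩
  map_src d := π.map_src d
  map_inv d := Subtype.ext (π.map_inv d)
  lift_unique := by
    rintro v ⟨d₀, hd₀⟩ hs
    obtain ⟨d, ⟨hd, rfl⟩, hu⟩ := π.lift_unique v d₀ hs
    exact ⟨⟨d, hd₀⟩, ⟨hd, rfl⟩, fun d' hd' =>
      Subtype.ext (hu d' ⟨hd'.1, congrArg Subtype.val hd'.2⟩)⟩

/-- The copy of the tree that contains a vertex. -/
def block {ℓ : ℕ} (π : Covering G G₀) (T : TreeCut G₀ ℓ) (v : V) : π.Block T :=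
  (π.overTree T).adjGraph.connectedComponentMk v

variable {ℓ : ℕ} (π : Covering G G₀) (T : TreeCut G₀ ℓ)

theorem existsUnique_block (B : π.Block T) (v₀ : V₀) :
    ∃! v, π.block T v = B ∧ π.onV v = v₀ :=
  (π.treeCovering T).existsUnique_of_isTree T.isTree B v₀

theorem block_src_eq_block_tgt {d : D} (hd : π.onD d ∉ G₀.halfEdges T.e) :
    π.block T (G.src d) = π.block T (G.tgt d) :=
  SimpleGraph.ConnectedComponent.eq.2 ((π.overTree T).reachable_src_tgt ⟨d, hd⟩)

/-- Vertices of the cover are pairs of a copy of the tree and a vertex of the tree. -/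
theorem sum_block_mul [Fintype V] [Fintype V₀] [Fintype (π.Block T)]
    (f : π.Block T → ℝ) (g : V₀ → ℝ) :
    ∑ v, f (π.block T v) * g (π.onV v) = (∑ B, f B) * ∑ v₀, g v₀ := by
  rw [Finset.sum_mul_sum, ← Fintype.sum_prod_type']
  refine Fintype.sum_bijective (fun v => (π.block T v, π.onV v)) ?_ _ _ fun _ => rfl
  constructor
  · intro v w hvw
    exact (π.existsUnique_block T (π.block T w) (π.onV w)).unique (Prod.ext_iff.1 hvw) ⟨rfl, rfl⟩
  · rintro ⟨B, v₀⟩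
    obtain ⟨v, ⟨h1, h2⟩, -⟩ := π.existsUnique_block T B v₀
    exact ⟨v, Prod.ext h1 h2⟩

open Classical in
/-- The half-edges of the skeleton at a vertex are copies of the half-edges of the cut edges. -/
theorem sum_skeleton_src [Fintype (π.onD ⁻¹' G₀.halfEdges T.e : Set D)] [Fintype D₀]
    (B : π.Block T) (c : D₀ → ℝ) :
    ∑ h with (π.skeleton T).src h = B, c (π.onD h) =
      ∑ i, (c (T.e i) + c (G₀.inv (T.e i))) := by
  have hcut : ∑ i, (c (T.e i) + c (G₀.inv (T.e i))) =
      ∑ d₀ with d₀ ∈ G₀.halfEdges T.e, c d₀ := by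
    have : ∑ x : Fin ℓ × Bool, c (if x.2 then T.e x.1 else G₀.inv (T.e x.1)) =
        ∑ d₀ with d₀ ∈ G₀.halfEdges T.e, c d₀ := by
      refine Finset.sum_bij (fun x _ => if x.2 then T.e x.1 else G₀.inv (T.e x.1)) ?_ ?_ ?_ ?_
      · rintro ⟨i, b⟩ -
        refine Finset.mem_filter.2 ⟨Finset.mem_univ _, i, ?_⟩
        cases b <;> simp
      · rintro ⟨i, b⟩ - ⟨k, b'⟩ -
        cases b <;> cases b' <;> simp only [Bool.false_eq_true, if_false, if_true]
        · intro h
          rw [T.injective (G₀.invEquiv.injective h)]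
        · exact fun h => absurd h.symm (T.ne_inv k i)
        · exact fun h => absurd h (T.ne_inv i k)
        · intro h
          rw [T.injective h]
      · intro d₀ hd₀
        obtain ⟨i, rfl | rfl⟩ := (Finset.mem_filter.1 hd₀).2
        · exact ⟨(i, true), Finset.mem_univ _, by simp⟩
        · exact ⟨(i, false), Finset.mem_univ _, by simp⟩
      · intro _ _; rfl
    rw [← this, Fintype.sum_prod_type]
    simp
  rw [hcut]
  refine Finset.sum_bij (fun h _ => π.onD h) ?_ ?_ ?_ ?_
  · exact fun h _ => Finset.mem_filter.2 ⟨Finset.mem_univ _, h.2⟩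
  · intro h hh h' hh' heq
    have hs : G.src h = G.src h' := by
      refine (π.existsUnique_block T B (π.onV (G.src h'))).unique
        ⟨(Finset.mem_filter.1 hh).2, ?_⟩ ⟨(Finset.mem_filter.1 hh').2, rfl⟩
      rw [π.map_src, π.map_src, heq]
    exact Subtype.ext ((π.lift_unique (G.src h') (π.onD h') (π.map_src _).symm).unique
      ⟨hs, heq⟩ ⟨rfl, rfl⟩)
  · intro d₀ hd₀
    obtain ⟨v, ⟨hv, hv₀⟩, -⟩ := π.existsUnique_block T B (G₀.src d₀)
    obtain ⟨d, ⟨hd, rfl⟩, -⟩ := π.lift_unique v d₀ hv₀.symm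
    refine ⟨⟨d, (Finset.mem_filter.1 hd₀).2⟩, Finset.mem_filter.2 ⟨Finset.mem_univ _, ?_⟩, rfl⟩
    rw [← hv, ← hd]
    rfl
  · intro _ _; rfl

end Covering

end MultiGraph

/-! ### Extremal characterizations of the two largest eigenvalues -/

namespace Matrix.IsHermitian

theorem dotProduct_mulVec_comm {n : Type*} [Fintype n] {A : Matrix n n ℝ} (hA : A.IsHermitian)
    (u v : n → ℝ) : u ⬝ᵥ A *ᵥ v = A *ᵥ u ⬝ᵥ v := by
  rw [Matrix.dotProduct_mulVec, ← Matrix.mulVec_transpose]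
  congr 2

variable {n : Type*} [Fintype n] [DecidableEq n] {A : Matrix n n ℝ} (hA : A.IsHermitian)

theorem sum_sq_eigenvectorBasis (u : n → ℝ) :
    ∑ i, (u ⬝ᵥ ⇑(hA.eigenvectorBasis i)) ^ 2 = u ⬝ᵥ u := by
  have := hA.eigenvectorBasis.sum_inner_mul_inner (WithLp.toLp 2 u) (WithLp.toLp 2 u)
  simp only [EuclideanSpace.inner_eq_star_dotProduct, star_trivial] at this
  rw [← this]
  exact Finset.sum_congr rfl fun i _ => by rw [sq, dotProduct_comm u]

theorem sum_eigenvalues_mul_sq (u : n → ℝ) :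
    ∑ i, hA.eigenvalues i * (u ⬝ᵥ ⇑(hA.eigenvectorBasis i)) ^ 2 = u ⬝ᵥ A *ᵥ u := by
  have := hA.eigenvectorBasis.sum_inner_mul_inner (WithLp.toLp 2 u) (WithLp.toLp 2 (A *ᵥ u))
  simp only [EuclideanSpace.inner_eq_star_dotProduct, star_trivial] at this
  rw [dotProduct_comm, ← this]
  refine Finset.sum_congr rfl fun i _ => ?_
  rw [← hA.dotProduct_mulVec_comm, hA.mulVec_eigenvectorBasis, dotProduct_smul, smul_eq_mul,
    dotProduct_comm u]
  ring

/-- The largest eigenvalue is at most `t` if the quadratic form is. -/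
theorem eigenvalues₀_zero_le (h : 0 < Fintype.card n) (t : ℝ)
    (ht : ∀ u : n → ℝ, u ⬝ᵥ A *ᵥ u ≤ t * (u ⬝ᵥ u)) : hA.eigenvalues₀ ⟨0, h⟩ ≤ t := by
  set i := Fintype.equivOfCardEq (Fintype.card_fin (Fintype.card n)) ⟨0, h⟩ with hi
  have hev : hA.eigenvalues i = hA.eigenvalues₀ ⟨0, h⟩ := by simp [eigenvalues, hi]
  have h1 := ht (hA.eigenvectorBasis i)
  have hn : (⇑(hA.eigenvectorBasis i) : n → ℝ) ⬝ᵥ ⇑(hA.eigenvectorBasis i) = 1 := by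
    have := hA.eigenvectorBasis.orthonormal.1 i
    rw [EuclideanSpace.norm_eq, Real.sqrt_eq_one] at this
    simpa [dotProduct, sq] using this
  rw [hA.mulVec_eigenvectorBasis, dotProduct_smul, hn, hev] at h1
  simpa using h1

/-- The max-min principle for the second largest eigenvalue: it is at least `t` if the quadratic
form is at least `t` on a plane. -/
theorem le_eigenvalues₀_one (h : 1 < Fintype.card n) (t : ℝ) (u v : n → ℝ)
    (hne : ∀ x z : ℝ, x ≠ 0 ∨ z ≠ 0 → x • u + z • v ≠ 0)
    (ht : ∀ x z : ℝ, t * ((x • u + z • v) ⬝ᵥ (x • u + z • v)) ≤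
      (x • u + z • v) ⬝ᵥ A *ᵥ (x • u + z • v)) : t ≤ hA.eigenvalues₀ ⟨1, h⟩ := by
  set i₀ := Fintype.equivOfCardEq (Fintype.card_fin (Fintype.card n)) ⟨0, by omega⟩ with hi₀
  -- The plane meets the orthogonal complement of the first eigenvector.
  obtain ⟨x, z, hxz, horth⟩ : ∃ x z : ℝ, (x ≠ 0 ∨ z ≠ 0) ∧
      (x • u + z • v) ⬝ᵥ ⇑(hA.eigenvectorBasis i₀) = 0 := by
    by_cases hu : u ⬝ᵥ ⇑(hA.eigenvectorBasis i₀) = 0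
    · exact ⟨1, 0, Or.inl one_ne_zero, by simp [hu]⟩
    · refine ⟨-(v ⬝ᵥ ⇑(hA.eigenvectorBasis i₀)), u ⬝ᵥ ⇑(hA.eigenvectorBasis i₀), Or.inr hu, ?_⟩
      rw [add_dotProduct, smul_dotProduct, smul_dotProduct, smul_eq_mul, smul_eq_mul]
      ring
  set w := x • u + z • v with hw
  have hpos : 0 < w ⬝ᵥ w := by
    refine lt_of_le_of_ne (Finset.sum_nonneg fun i _ => mul_self_nonneg _) fun h0 => ?_
    exact hne x z hxz (dotProduct_self_eq_zero.1 h0.symm)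
  have hle : w ⬝ᵥ A *ᵥ w ≤ hA.eigenvalues₀ ⟨1, h⟩ * (w ⬝ᵥ w) := by
    rw [← hA.sum_eigenvalues_mul_sq, ← hA.sum_sq_eigenvectorBasis, Finset.mul_sum]
    refine Finset.sum_le_sum fun i _ => ?_
    by_cases hi : i = i₀
    · rw [hi, horth]; simp
    · refine mul_le_mul_of_nonneg_right (hA.eigenvalues₀_antitone ?_) (sq_nonneg _)
      rw [Fin.le_def]
      by_contra hlt
      apply hi
      rw [hi₀, ← Equiv.symm_apply_eq]
      ext
      simp only at hlt ⊢
      omega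
  exact le_of_mul_le_mul_right ((ht x z).trans hle) hpos

end Matrix.IsHermitian

/-! ### The ground state representation of a Jacobi matrix -/

namespace MultiGraph

variable {V D V₀ D₀ : Type*} {G : MultiGraph V D} {G₀ : MultiGraph V₀ D₀}

namespace Jacobi

theorem matrix_mulVec [Fintype V] [DecidableEq V] [Fintype D] (J : Jacobi G) (u : V → ℝ) (v : V) :
    (J.matrix *ᵥ u) v = J.b v * u v + ∑ d with G.src d = v, J.a d * u (G.tgt d) := by
  simp only [matrix, Matrix.mulVec, dotProduct, Matrix.of_apply, add_mul, Finset.sum_add_distrib,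
    ite_mul, zero_mul, Finset.sum_ite_eq, Finset.mem_univ, if_true]
  congr 1
  rw [← Finset.sum_fiberwise_of_maps_to (t := Finset.univ) (g := G.tgt)
    (fun _ _ => Finset.mem_univ _)]
  refine Finset.sum_congr rfl fun w _ => ?_
  rw [Finset.sum_mul, Finset.filter_filter]
  refine Finset.sum_congr rfl fun d hd => ?_
  rw [(Finset.mem_filter.1 hd).2.2]

/-- The ground state representation: relative to an eigenvector `Y`, the quadratic form of a Jacobi
matrix becomes a Dirichlet form. -/
theorem dotProduct_mulVec_mul [Fintype V] [DecidableEq V] [Fintype D] (J : Jacobi G) (Y : V → ℝ)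
    (E : ℝ) (hY : J.matrix *ᵥ Y = E • Y) (g : V → ℝ) :
    (g * Y) ⬝ᵥ J.matrix *ᵥ (g * Y) = E * ((g * Y) ⬝ᵥ (g * Y)) -
      (∑ d, J.a d * Y (G.src d) * Y (G.tgt d) * (g (G.src d) - g (G.tgt d)) ^ 2) / 2 := by
  have hsum : ∀ φ ψ : V → ℝ, ∑ v, φ v * ∑ d with G.src d = v, J.a d * ψ (G.tgt d) =
      ∑ d, φ (G.src d) * (J.a d * ψ (G.tgt d)) := by
    intro φ ψ
    rw [← Finset.sum_fiberwise_of_maps_to (t := Finset.univ) (g := G.src)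
      (fun _ _ => Finset.mem_univ _)]
    refine Finset.sum_congr rfl fun v _ => ?_
    rw [Finset.mul_sum]
    refine Finset.sum_congr rfl fun d hd => ?_
    rw [(Finset.mem_filter.1 hd).2]
  have h1 : (g * Y) ⬝ᵥ J.matrix *ᵥ (g * Y) = ∑ v, (g * Y) v * (J.b v * (g * Y) v) +
      ∑ d, (g * Y) (G.src d) * (J.a d * (g * Y) (G.tgt d)) := by
    rw [← hsum, ← Finset.sum_add_distrib]
    exact Finset.sum_congr rfl fun v _ => by rw [J.matrix_mulVec]; ring
  have h2 : E * ((g * Y) ⬝ᵥ (g * Y)) = ∑ v, (g * Y) v * (J.b v * (g * Y) v) +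
      ∑ d, (g ^ 2 * Y) (G.src d) * (J.a d * Y (G.tgt d)) := by
    rw [← hsum, ← Finset.sum_add_distrib, dotProduct, Finset.mul_sum]
    refine Finset.sum_congr rfl fun v _ => ?_
    have hv := congrFun hY v
    rw [J.matrix_mulVec, Pi.smul_apply, smul_eq_mul] at hv
    simp only [Pi.mul_apply, Pi.pow_apply]
    linear_combination -(g v ^ 2 * Y v) * hv
  have h3 : ∑ d, (g ^ 2 * Y) (G.src d) * (J.a d * Y (G.tgt d)) =
      ∑ d, (g ^ 2 * Y) (G.tgt d) * (J.a d * Y (G.src d)) := by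
    rw [← G.sum_inv]
    exact Finset.sum_congr rfl fun d _ => by rw [J.a_inv, tgt_inv, tgt]
  have h4 : (∑ d, J.a d * Y (G.src d) * Y (G.tgt d) * (g (G.src d) - g (G.tgt d)) ^ 2) =
      ∑ d, (g ^ 2 * Y) (G.src d) * (J.a d * Y (G.tgt d)) +
      ∑ d, (g ^ 2 * Y) (G.tgt d) * (J.a d * Y (G.src d)) -
      2 * ∑ d, (g * Y) (G.src d) * (J.a d * (g * Y) (G.tgt d)) := by
    rw [Finset.mul_sum, ← Finset.sum_add_distrib, ← Finset.sum_sub_distrib]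
    refine Finset.sum_congr rfl fun d _ => ?_
    simp only [Pi.mul_apply, Pi.pow_apply]
    ring
  rw [h1, h2, h4, ← h3]
  ring

/-- An eigenvector lifts to every cover. -/
theorem lift_mulVec [Fintype V₀] [DecidableEq V₀] [Fintype D₀] [Fintype V] [DecidableEq V]
    [Fintype D] (J₀ : Jacobi G₀) (π : Covering G G₀) (y : V₀ → ℝ) (E : ℝ)
    (hy : J₀.matrix *ᵥ y = E • y) : (J₀.lift π).matrix *ᵥ (y ∘ π.onV) = E • (y ∘ π.onV) := by
  ext v
  have hv := congrFun hy (π.onV v)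
  rw [matrix_mulVec] at hv ⊢
  rw [Pi.smul_apply] at hv ⊢
  refine Eq.trans (congrArg (J₀.b (π.onV v) * y (π.onV v) + ·) ?_) hv
  refine Finset.sum_bij (fun d _ => π.onD d) ?_ ?_ ?_ ?_
  · intro d hd
    refine Finset.mem_filter.2 ⟨Finset.mem_univ _, ?_⟩
    rw [← π.map_src, (Finset.mem_filter.1 hd).2]
  · intro d hd d' hd' heq
    have hs' := (Finset.mem_filter.1 hd').2
    exact (π.lift_unique v (π.onD d') (by rw [← π.map_src, hs'])).unique
      ⟨(Finset.mem_filter.1 hd).2, heq⟩ ⟨hs', rfl⟩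
  · intro d₀ hd₀
    obtain ⟨d, ⟨hd, rfl⟩, -⟩ := π.lift_unique v d₀ (Finset.mem_filter.1 hd₀).2
    exact ⟨d, Finset.mem_filter.2 ⟨Finset.mem_univ _, hd⟩, rfl⟩
  · intro d _
    rw [← π.map_tgt]
    rfl

/-- The positive lift of a positive eigenvector shows that no eigenvalue of a lift exceeds that
of the eigenvector. -/
theorem eig_lift_zero_le [Fintype V₀] [DecidableEq V₀] [Fintype D₀] [Fintype V] [DecidableEq V]
    [Fintype D] [Nonempty V] (J₀ : Jacobi G₀) (π : Covering G G₀) {y : V₀ → ℝ} {E : ℝ}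
    (hpos : ∀ v, 0 < y v) (hy : J₀.matrix *ᵥ y = E • y) : (J₀.lift π).eig 0 ≤ E := by
  rw [eig, dif_pos Fintype.card_pos]
  refine (J₀.lift π).isHermitian_matrix.eigenvalues₀_zero_le _ _ fun u => ?_
  have hu : u = (u / (y ∘ π.onV)) * (y ∘ π.onV) := by
    ext v
    simp [(hpos (π.onV v)).ne']
  rw [hu, (J₀.lift π).dotProduct_mulVec_mul _ _ (J₀.lift_mulVec π y _ hy)]
  refine sub_le_self _ (div_nonneg (Finset.sum_nonneg fun d _ => ?_) zero_le_two)
  exact mul_nonneg (mul_nonneg (mul_nonneg ((J₀.lift π).a_pos d).le (hpos _).le)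
    (hpos _).le) (sq_nonneg _)

/-- The weight of a half-edge in the Dirichlet form relative to `y`. -/
def groundWeight (J : Jacobi G) (y : V → ℝ) (d : D) : ℝ :=
  J.a d * y (G.src d) * y (G.tgt d)

theorem groundWeight_inv (J : Jacobi G) (y : V → ℝ) (d : D) :
    J.groundWeight y (G.inv d) = J.groundWeight y d := by
  rw [groundWeight, groundWeight, J.a_inv, tgt_inv, tgt]
  ring

theorem cutMatrix_mulVec_dotProduct [Fintype V] [DecidableEq V] {ℓ : ℕ} (J : Jacobi G)
    (T : TreeCut G ℓ) (y : V → ℝ) (i : Fin ℓ) :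
    (J.cutMatrix T i *ᵥ y) ⬝ᵥ y = J.groundWeight y (T.e i) := by
  rw [cutMatrix, Matrix.single_mulVec, groundWeight]
  simp [dotProduct, Function.update_apply]
  ring

theorem totalCutMatrix_mulVec_dotProduct [Fintype V] [DecidableEq V] {ℓ : ℕ} (J : Jacobi G)
    (T : TreeCut G ℓ) (y : V → ℝ) :
    (J.totalCutMatrix T *ᵥ y) ⬝ᵥ y =
      ∑ i, (J.groundWeight y (T.e i) + J.groundWeight y (G.inv (T.e i))) := by
  rw [totalCutMatrix, Matrix.sum_mulVec, sum_dotProduct]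
  refine Finset.sum_congr rfl fun i _ => ?_
  rw [Matrix.add_mulVec, add_dotProduct, groundWeight_inv, cutMatrix_mulVec_dotProduct,
    Matrix.mulVec_transpose, ← Matrix.dotProduct_mulVec, dotProduct_comm,
    cutMatrix_mulVec_dotProduct]

end Jacobi

end MultiGraph

/-! ### Test functions and the bound on the spectral gap -/

namespace MultiGraph

namespace Covering

variable {V D V₀ D₀ : Type*} {G : MultiGraph V D} {G₀ : MultiGraph V₀ D₀}
  (π : Covering G G₀) {ℓ : ℕ} (T : TreeCut G₀ ℓ) (J₀ : G₀.Jacobi) {y : V₀ → ℝ}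

/-- The lift of a function on the skeleton: on each copy of the tree, a multiple of `y`. -/
def liftFun (y : V₀ → ℝ) (f : π.Block T → ℝ) : V → ℝ :=
  (f ∘ π.block T) * (y ∘ π.onV)

theorem liftFun_dotProduct_self [Fintype V₀] [Fintype V] [Fintype (π.Block T)]
    (hy : y ⬝ᵥ y = 1) (f : π.Block T → ℝ) :
    π.liftFun T y f ⬝ᵥ π.liftFun T y f = ∑ B, f B ^ 2 := by
  have := π.sum_block_mul T (fun B => f B ^ 2) (fun v => y v * y v)
  rw [show ∑ v, y v * y v = 1 from hy, mul_one] at this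
  rw [← this]
  refine Finset.sum_congr rfl fun v _ => ?_
  simp only [liftFun, Pi.mul_apply, Function.comp_apply]
  ring

/-- Only the cut edges contribute to the Dirichlet form of a lifted function. -/
theorem liftFun_dotProduct_mulVec [Fintype V₀] [DecidableEq V₀] [Fintype D₀] [Fintype V]
    [DecidableEq V] [Fintype D] [Fintype (π.Block T)]
    [Fintype (π.onD ⁻¹' G₀.halfEdges T.e : Set D)] {E : ℝ} (hE : J₀.matrix *ᵥ y = E • y)
    (hy : y ⬝ᵥ y = 1) (f : π.Block T → ℝ) :
    π.liftFun T y f ⬝ᵥ (J₀.lift π).matrix *ᵥ π.liftFun T y f = E * ∑ B, f B ^ 2 -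
      (∑ h : (π.onD ⁻¹' G₀.halfEdges T.e : Set D), J₀.groundWeight y (π.onD h) *
        (f ((π.skeleton T).src h) - f ((π.skeleton T).tgt h)) ^ 2) / 2 := by
  classical
  rw [← π.liftFun_dotProduct_self T hy, liftFun,
    (J₀.lift π).dotProduct_mulVec_mul _ E (J₀.lift_mulVec π y E hE)]
  congr 2
  rw [← Finset.sum_filter_of_ne (p := (· ∈ π.onD ⁻¹' G₀.halfEdges T.e))]
  · rw [Finset.sum_subtype _ (p := (· ∈ π.onD ⁻¹' G₀.halfEdges T.e)) (fun d => by simp)]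
    refine Finset.sum_congr rfl fun h _ => ?_
    rw [Jacobi.groundWeight, ← π.map_src, ← π.map_tgt]
    rfl
  · intro d _ hne
    by_contra hd
    apply hne
    simp only [Function.comp_apply]
    rw [π.block_src_eq_block_tgt T hd]
    ring

end Covering

end MultiGraph

theorem mainTheorem2 {V₀ D₀ V D : Type*} [Fintype V₀] [DecidableEq V₀] [Fintype D₀]
    [Fintype V] [DecidableEq V] [Fintype D]
    {G₀ : MultiGraph V₀ D₀} {G : MultiGraph V D}
    (J₀ : G₀.Jacobi) (π : MultiGraph.Covering G G₀) {ℓ : ℕ} (T : G₀.TreeCut ℓ) (j : Fin ℓ)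
    (r : ℝ) (hr : 0 < r)
    (e₁ e₂ : (π.onD ⁻¹' G₀.halfEdges T.e : Set D)) (h₁ : π.IsOver T j e₁) (h₂ : π.IsOver T j e₂)
    (hfar : ∀ s ∈ ({(π.skeleton T).src e₁, (π.skeleton T).tgt e₁} : Set (π.Block T)),
      ∀ t ∈ ({(π.skeleton T).src e₂, (π.skeleton T).tgt e₂} : Set (π.Block T)),
        ENNReal.ofReal (2 * r + 2) < ((π.skeleton T).adjGraph.edist s t : ℝ≥0∞))
    (y : V₀ → ℝ) (hy : J₀.IsPerronVector y) :
    (J₀.lift π).eig 0 - (J₀.lift π).eig 1 ≤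
      (2 * (ℓ : ℝ) - 2 * √(2 * (ℓ : ℝ) - 1)) *
          (((J₀.totalCutMatrix T *ᵥ y) ⬝ᵥ y) / (2 * (ℓ : ℝ))) +
        J₀.errorConst T y j / r := by
  classical
  have : Fintype (π.Block T) := Fintype.ofFinite _
  set S := π.skeleton T with hS
  set c : (π.onD ⁻¹' G₀.halfEdges T.e : Set D) → ℝ := fun h => J₀.groundWeight y (π.onD h) with hc
  set m := ((J₀.totalCutMatrix T *ᵥ y) ⬝ᵥ y) / (2 * (ℓ : ℝ)) with hm
  set q : ℝ := 2 * (ℓ : ℝ) - 1 with hq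
  set n := ⌊r⌋₊ with hn
  have hℓ : (1 : ℝ) ≤ ℓ := by exact_mod_cast (Nat.zero_le _).trans_lt j.2
  have hq1 : 1 ≤ q := by rw [hq]; linarith
  have hsq : 1 ≤ √q := Real.one_le_sqrt.2 hq1
  have hss : √q * √q = q := Real.mul_self_sqrt (by linarith)
  obtain ⟨p, hp, hp1, hpq, hpq'⟩ : ∃ p : ℝ, 0 < p ∧ p ≤ 1 ∧ p ^ 2 * q = 1 ∧ p * q = √q := by
    refine ⟨(√q)⁻¹, by positivity, inv_le_one_of_one_le₀ hsq, ?_, ?_⟩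
    · nth_rewrite 2 [← hss]
      field_simp
    · nth_rewrite 2 [← hss]
      field_simp
  have hweight : ∀ d, 0 < J₀.groundWeight y d := fun d =>
    mul_pos (mul_pos (J₀.a_pos d) (hy.pos _)) (hy.pos _)
  have hcinv : ∀ h, c (S.inv h) = c h := fun h => by
    rw [hc]
    exact (congrArg _ (π.map_inv h)).trans (J₀.groundWeight_inv y _)
  have hdeg : ∀ B, ∑ h with S.src h = B, (1 : ℝ) = q + 1 := by
    intro B
    have := π.sum_skeleton_src T B (fun _ => 1)
    rw [this, hq]
    simp
    ring
  have htot : ∀ B, ∑ h with S.src h = B, c h = (q + 1) * m := by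
    intro B
    rw [π.sum_skeleton_src T B (J₀.groundWeight y), ← J₀.totalCutMatrix_mulVec_dotProduct, hm, hq]
    field_simp
    ring
  have hover : ∀ e, π.IsOver T j e → c e = (J₀.cutMatrix T j *ᵥ y) ⬝ᵥ y := by
    rintro e (he | he)
    · rw [J₀.cutMatrix_mulVec_dotProduct, hc, ← he]
    · rw [J₀.cutMatrix_mulVec_dotProduct, hc, ← J₀.groundWeight_inv, ← he]
  -- Each test function uses the levels `0, …, n`, and `r < n + 1`.
  set K := (q + 1 - 2 * √q) * m +
    ((2 * √q - 1) * m + |m - (J₀.cutMatrix T j *ᵥ y) ⬝ᵥ y|) / (n + 1) with hK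
  have hdir : ∀ e, π.IsOver T j e →
      (∑ h, c h * (S.radial e q n (S.src h) - S.radial e q n (S.tgt h)) ^ 2) / 2 ≤
        2 * (n + 1) * K := by
    intro e he
    refine (S.dirichlet_radial_le e hp hp1 hpq hdeg c hcinv (fun h => (hweight _).le) m htot
      n).trans_eq ?_
    rw [hover e he, hpq', hK]
    field_simp
  have hsep := S.radial_separated hr.le hfar q
  have hnorm : ∀ x z : ℝ, ∑ B, (x • S.radial e₁ q n + z • S.radial e₂ q n) B ^ 2 =
      (x ^ 2 + z ^ 2) * (2 * (n + 1)) := by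
    intro x z
    rw [S.sum_sq_of_separated hsep, S.sum_radial_sq e₁ (by linarith) hdeg,
      S.sum_radial_sq e₂ (by linarith) hdeg]
    ring
  -- The far-apart edges start in different copies of the tree, so there are two eigenvalues.
  have hcard : 1 < Fintype.card V := by
    rw [Fintype.one_lt_card_iff]
    refine ⟨G.src e₁, G.src e₂, fun heq => ?_⟩
    have h0 := hfar (S.src e₁) (by simp) (S.src e₂) (by simp)
    have hB : S.src e₁ = S.src e₂ := congrArg (π.block T) heq
    rw [hB, SimpleGraph.edist_self] at h0
    simp at h0
  have : Nonempty V := ⟨G.src e₁⟩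
  have htop : (J₀.lift π).eig 0 ≤ J₀.eig 0 := J₀.eig_lift_zero_le π hy.pos hy.eigen
  -- On the plane spanned by the two lifted test functions the quadratic form is at least
  -- `J₀.eig 0 - K`.
  have hsecond : J₀.eig 0 - K ≤ (J₀.lift π).eig 1 := by
    rw [MultiGraph.Jacobi.eig.eq_def (J₀.lift π), dif_pos hcard]
    have hlin : ∀ x z : ℝ, x • π.liftFun T y (S.radial e₁ q n) +
        z • π.liftFun T y (S.radial e₂ q n) =
          π.liftFun T y (x • S.radial e₁ q n + z • S.radial e₂ q n) := by
      intro x z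
      ext v
      simp only [MultiGraph.Covering.liftFun, Pi.add_apply, Pi.smul_apply, Pi.mul_apply,
        smul_eq_mul, Function.comp_apply]
      ring
    refine (J₀.lift π).isHermitian_matrix.le_eigenvalues₀_one hcard _
      (π.liftFun T y (S.radial e₁ q n)) (π.liftFun T y (S.radial e₂ q n)) ?_ ?_
    · intro x z hxz h0
      have h1 := π.liftFun_dotProduct_self T hy.unit (x • S.radial e₁ q n + z • S.radial e₂ q n)
      rw [← hlin, h0, zero_dotProduct, hnorm] at h1
      have h2 : 0 < x ^ 2 + z ^ 2 := by
        rcases hxz with hx | hz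
        · positivity
        · positivity
      have h3 : 0 < (x ^ 2 + z ^ 2) * (2 * ((n : ℝ) + 1)) := by positivity
      exact h3.ne h1
    · intro x z
      rw [hlin, π.liftFun_dotProduct_self T hy.unit,
        π.liftFun_dotProduct_mulVec T J₀ hy.eigen hy.unit]
      rw [hnorm, sub_mul]
      refine sub_le_sub_left ?_ _
      rw [S.dirichlet_of_separated hsep c]
      have h1 := mul_le_mul_of_nonneg_left (hdir e₁ h₁) (sq_nonneg x)
      have h2 := mul_le_mul_of_nonneg_left (hdir e₂ h₂) (sq_nonneg z)
      linarith
  have hm0 : 0 ≤ m := by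
    rw [hm, J₀.totalCutMatrix_mulVec_dotProduct]
    exact div_nonneg (Finset.sum_nonneg fun i _ => (add_pos (hweight _) (hweight _)).le)
      (by positivity)
  have hKle : K ≤ (2 * (ℓ : ℝ) - 2 * √q) * m + J₀.errorConst T y j / r := by
    have hrn : r ≤ n + 1 := (Nat.lt_floor_add_one r).le
    have hnum : 0 ≤ (2 * √q - 1) * m + |m - (J₀.cutMatrix T j *ᵥ y) ⬝ᵥ y| :=
      add_nonneg (mul_nonneg (by linarith) hm0) (abs_nonneg _)
    rw [hK, hq, sub_add_cancel, MultiGraph.Jacobi.errorConst]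
    exact add_le_add_right (div_le_div_of_nonneg_left hnum hr hrn) _
  linarith
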